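/- Let $\Gamma^*\subset\mathrm{O}(4)$ be a finite group of orthogonal $4\times4$ real matrices that is not contained in $\mathrm{SO}(4)$ and whose natural action on $\mathbb{R}^4$ is irreducible (over $\mathbb{R}$). Then $\Gamma^*$ possesses at least one axis of symmetry: there is a subgroup $\Sigma\subset\Gamma^*$ whose fixed-point subspace $$\mathrm{Fix}(\Sigma)=\{x\in\mathbb{R}^4 : \sigma x=x\ \text{for all}\ \sigma\in\Sigma\}$$ has dimension $1$. -/

import Mathlib

namespace FiniteOrthogonal

/-- The natural action of a subgroup `Γ` of `O(n)` on `ℝⁿ`, by matrix-vector multiplication. -/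
def naturalRep {n : ℕ} (Γ : Subgroup (Matrix.orthogonalGroup (Fin n) ℝ)) :
    Representation ℝ Γ (Fin n → ℝ) where
  toFun γ := Matrix.mulVecLin (γ : Matrix (Fin n) (Fin n) ℝ)
  map_one' := by simp [Module.End.one_eq_id]
  map_mul' γ δ := by simp [Matrix.mulVecLin_mul, Module.End.mul_eq_comp]

/-- The fixed-point subspace `Fix(S) = {x ∈ ℝⁿ : σ x = x for all σ ∈ S}`. -/
def fixedSubspace {n : ℕ} (S : Subgroup (Matrix.orthogonalGroup (Fin n) ℝ)) :
    Submodule ℝ (Fin n → ℝ) where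
  carrier := {x | ∀ σ ∈ S, Matrix.mulVec (σ : Matrix (Fin n) (Fin n) ℝ) x = x}
  zero_mem' σ _ := Matrix.mulVec_zero _
  add_mem' {x y} hx hy σ hσ := by rw [Matrix.mulVec_add, hx σ hσ, hy σ hσ]
  smul_mem' c x hx σ hσ := by rw [Matrix.mulVec_smul, hx σ hσ]

/-- An axis of symmetry of `Γ`: a one-dimensional fixed-point subspace of a subgroup of `Γ`. -/
def IsAxisOfSymmetry {n : ℕ} (Γ : Subgroup (Matrix.orthogonalGroup (Fin n) ℝ))
    (L : Submodule ℝ (Fin n → ℝ)) : Prop :=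
  Module.finrank ℝ L = 1 ∧
    ∃ S : Subgroup (Matrix.orthogonalGroup (Fin n) ℝ), S ≤ Γ ∧ L = fixedSubspace S

end FiniteOrthogonal

/-! Some `g ∈ Γ` has determinant -1, and in even dimension its fixed space has odd dimension, here 1
or 3. Dimension 1 is already an axis. Dimension 3 makes `g` a reflection; by irreducibility, any
nonzero vector fixed by a subgroup is moved by some conjugate of `g`, and adjoining that conjugate
cuts the fixed space by exactly one dimension. Descending from dimension 4 reaches 1
(`exists_finrank_fixedSubspace_eq`). -/

open Module

namespace LinearMap

variable {E : Type*} [NormedAddCommGroup E] [InnerProductSpace ℝ E] [FiniteDimensional ℝ E]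

theorem det_adjoint_real (f : E →ₗ[ℝ] E) : LinearMap.det (adjoint f) = LinearMap.det f := by
  let b := stdOrthonormalBasis ℝ E
  rw [← det_toMatrix b.toBasis, ← det_toMatrix b.toBasis f, toMatrix_adjoint,
    Matrix.det_conjTranspose, star_trivial]

/-- An orientation-reversing isometry of an even-dimensional space fixes a nonzero vector. -/
theorem exists_fixed_ne_zero_of_det_eq_neg_one (hE : Even (finrank ℝ E)) (f : E →ₗ[ℝ] E)
    (hf : adjoint f * f = 1) (hdet : LinearMap.det f = -1) : ∃ x, x ≠ 0 ∧ f x = x := by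
  have hker : LinearMap.det (f - 1) = 0 := by
    -- Taking determinants in even dimension, with `d = det (f - 1)`, this identity yields `-d = d`.
    have h : adjoint f * (f - 1) = (-1 : ℝ) • adjoint (f - 1) := by
      have h1 : adjoint (1 : E →ₗ[ℝ] E) = 1 := adjoint_id
      rw [mul_sub, hf, map_sub, h1, mul_one, neg_one_smul, neg_sub]
    have := congrArg LinearMap.det h
    rw [map_mul, det_adjoint_real, hdet, LinearMap.det_smul, hE.neg_one_pow,
      det_adjoint_real] at this
    linarith
  obtain ⟨x, hx, hx0⟩ := Submodule.exists_mem_ne_zero_of_ne_bot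
    (det_eq_zero_iff_ker_ne_bot.mp hker)
  exact ⟨x, hx0, by simpa [sub_eq_zero] using hx⟩

/-- The fixed space of an orientation-reversing isometry of an even-dimensional space has odd
dimension. -/
theorem odd_finrank_ker_sub_one (hE : Even (finrank ℝ E)) (f : E →ₗ[ℝ] E)
    (hf : adjoint f * f = 1) (hdet : LinearMap.det f = -1) :
    Odd (finrank ℝ (ker (f - 1))) := by
  rw [← Nat.not_even_iff_odd]
  intro hV
  set V := ker (f - 1) with hVdef
  have hfix (x : E) : x ∈ V ↔ f x = x := by simp [hVdef, sub_eq_zero]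
  have hinner (x y : E) : inner ℝ (f x) (f y) = inner ℝ x y := by
    rw [← adjoint_inner_left, ← Module.End.mul_apply, hf, Module.End.one_apply]
  -- `s` negates `V` and fixes `Vᗮ`. If `dim V` were even, then `det s = 1`, so `f * s` would again
  -- fix some nonzero `a + b`.
  let s : E →ₗ[ℝ] E := Vᗮ.reflection.toLinearMap
  have hs : adjoint (f * s) * (f * s) = 1 := by
    ext x
    refine ext_inner_right ℝ fun y => ?_
    rw [Module.End.mul_apply, adjoint_inner_left, Module.End.mul_apply, Module.End.mul_apply,
      hinner, Module.End.one_apply]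
    exact Vᗮ.reflection.inner_map_map x y
  have hsdet : LinearMap.det (f * s) = -1 := by
    rw [map_mul, hdet, Submodule.det_reflection, Submodule.orthogonal_orthogonal,
      hV.neg_one_pow, mul_one]
  obtain ⟨x, hx0, hx⟩ := exists_fixed_ne_zero_of_det_eq_neg_one hE (f * s) hs hsdet
  obtain ⟨a, ha, b, hb, rfl⟩ := V.exists_add_mem_mem_orthogonal x
  have hsab : s (a + b) = -a + b := by
    have h1 : s a = -a := Submodule.reflection_mem_subspace_orthogonalComplement_eq_neg
      (by rwa [Submodule.orthogonal_orthogonal])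
    have h2 : s b = b := Submodule.reflection_mem_subspace_eq_self hb
    rw [map_add, h1, h2]
  have hab : f b - b = (2 : ℝ) • a := by
    rw [Module.End.mul_apply, hsab, map_add, map_neg, (hfix a).1 ha] at hx
    rw [two_smul, sub_eq_iff_eq_add, add_assoc, ← hx, add_neg_cancel_left]
  -- `f` fixes `a` and preserves inner products, so `f b - b = 2a` is orthogonal to `a`.
  have ha0 : a = 0 := by
    have h1 : inner ℝ a (f b) = 0 := by
      rw [← (hfix a).1 ha, hinner]
      exact hb a ha
    have h2 : inner ℝ a b = 0 := hb a ha
    have h3 := congrArg (inner ℝ a) hab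
    rw [inner_sub_right, h1, h2, inner_smul_right] at h3
    exact (inner_self_eq_zero (𝕜 := ℝ)).mp (by linarith)
  rw [ha0, smul_zero, sub_eq_zero] at hab
  have hb0 : b = 0 := (inner_self_eq_zero (𝕜 := ℝ)).mp (hb b ((hfix b).2 hab))
  exact hx0 (by rw [ha0, hb0, add_zero])

end LinearMap

namespace FiniteOrthogonal

variable {n : ℕ}

theorem mem_fixedSubspace {S : Subgroup (Matrix.orthogonalGroup (Fin n) ℝ)} {x : Fin n → ℝ} :
    x ∈ fixedSubspace S ↔
      ∀ σ ∈ S, Matrix.mulVec (σ : Matrix (Fin n) (Fin n) ℝ) x = x :=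
  Iff.rfl

theorem mem_fixedSubspace_closure {s : Set (Matrix.orthogonalGroup (Fin n) ℝ)} {x : Fin n → ℝ} :
    x ∈ fixedSubspace (Subgroup.closure s) ↔
      ∀ σ ∈ s, Matrix.mulVec (σ : Matrix (Fin n) (Fin n) ℝ) x = x := by
  refine ⟨fun h σ hσ => h σ (Subgroup.subset_closure hσ), fun h σ hσ => ?_⟩
  induction hσ using Subgroup.closure_induction with
  | mem σ hσ => exact h σ hσ
  | one => simp
  | mul σ τ _ _ hσ hτ => rw [Submonoid.coe_mul, ← Matrix.mulVec_mulVec, hτ, hσ]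
  | inv σ _ hσ =>
    have : Matrix.mulVec ((σ⁻¹ * σ : Matrix.orthogonalGroup (Fin n) ℝ) :
        Matrix (Fin n) (Fin n) ℝ) x = x := by simp
    rwa [Submonoid.coe_mul, ← Matrix.mulVec_mulVec, hσ] at this

theorem mem_fixedSubspace_zpowers {g : Matrix.orthogonalGroup (Fin n) ℝ} {x : Fin n → ℝ} :
    x ∈ fixedSubspace (Subgroup.zpowers g) ↔
      Matrix.mulVec (g : Matrix (Fin n) (Fin n) ℝ) x = x := by
  rw [Subgroup.zpowers_eq_closure, mem_fixedSubspace_closure]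
  simp

theorem fixedSubspace_sup (S T : Subgroup (Matrix.orthogonalGroup (Fin n) ℝ)) :
    fixedSubspace (S ⊔ T) = fixedSubspace S ⊓ fixedSubspace T := by
  ext x
  rw [Subgroup.sup_eq_closure, mem_fixedSubspace_closure, Submodule.mem_inf, mem_fixedSubspace,
    mem_fixedSubspace]
  exact ⟨fun h => ⟨fun σ hσ => h σ (Or.inl hσ), fun σ hσ => h σ (Or.inr hσ)⟩,
    fun h σ hσ => hσ.elim (h.1 σ) (h.2 σ)⟩

theorem finrank_fixedSubspace_zpowers_le_conj (γ g : Matrix.orthogonalGroup (Fin n) ℝ) :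
    finrank ℝ (fixedSubspace (Subgroup.zpowers g)) ≤
      finrank ℝ (fixedSubspace (Subgroup.zpowers (γ * g * γ⁻¹))) := by
  let f := Matrix.mulVecLin (γ : Matrix (Fin n) (Fin n) ℝ)
  have hinv (x : Fin n → ℝ) : Matrix.mulVec ((γ⁻¹ : Matrix.orthogonalGroup (Fin n) ℝ) :
      Matrix (Fin n) (Fin n) ℝ) (f x) = x := by
    rw [Matrix.mulVecLin_apply, Matrix.mulVec_mulVec, ← Submonoid.coe_mul, inv_mul_cancel]
    simp
  have hf : Function.Injective f := fun x y h => by rw [← hinv x, h, hinv]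
  rw [(Submodule.equivMapOfInjective f hf _).finrank_eq]
  refine Submodule.finrank_mono ?_
  rintro _ ⟨x, hx, rfl⟩
  rw [SetLike.mem_coe, mem_fixedSubspace_zpowers] at hx
  rw [mem_fixedSubspace_zpowers, Submonoid.coe_mul, Submonoid.coe_mul, ← Matrix.mulVec_mulVec,
    hinv, ← Matrix.mulVec_mulVec, hx]
  rfl

/-- In an irreducible group, a nonzero vector is moved by some conjugate of any given
nontrivial element. -/
theorem exists_conj_not_fixed {Γ : Subgroup (Matrix.orthogonalGroup (Fin n) ℝ)}
    (hirr : (naturalRep Γ).IsIrreducible) {g : Matrix.orthogonalGroup (Fin n) ℝ}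
    (hg : fixedSubspace (Subgroup.zpowers g) ≠ ⊤) {x : Fin n → ℝ} (hx : x ≠ 0) :
    ∃ γ ∈ Γ, x ∉ fixedSubspace (Subgroup.zpowers (γ * g * γ⁻¹)) := by
  by_contra! h
  -- The vectors whose whole `Γ`-orbit is fixed by `g`.
  let U : Subrepresentation (naturalRep Γ) :=
    { toSubmodule := ⨅ γ : Γ, (fixedSubspace (Subgroup.zpowers g)).comap (naturalRep Γ γ)
      apply_mem_toSubmodule := fun δ v hv => by
        simp only [Submodule.mem_iInf, Submodule.mem_comap] at hv ⊢
        intro γ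
        rw [← Module.End.mul_apply, ← map_mul]
        exact hv (γ * δ) }
  have hxU : x ∈ U.toSubmodule := by
    simp only [U, Submodule.mem_iInf, Submodule.mem_comap]
    intro γ
    have := h _ (Γ.inv_mem γ.2)
    rw [mem_fixedSubspace_zpowers] at this ⊢
    have h2 := congrArg (Matrix.mulVec (γ.1 : Matrix (Fin n) (Fin n) ℝ)) this
    rwa [Matrix.mulVec_mulVec, ← Submonoid.coe_mul, inv_inv, ← mul_assoc, ← mul_assoc,
      mul_inv_cancel, one_mul, Submonoid.coe_mul, ← Matrix.mulVec_mulVec] at h2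
  rcases hirr.eq_bot_or_eq_top U with hU | hU
  · rw [hU] at hxU
    exact hx hxU
  · refine hg (eq_top_iff.mpr fun y _ => ?_)
    have hy : y ∈ U.toSubmodule := by
      rw [hU]
      exact Submodule.mem_top
    simp only [U, Submodule.mem_iInf, Submodule.mem_comap] at hy
    simpa using hy 1

/-- If an irreducible group contains a reflection, its subgroups have fixed-point subspaces of
every dimension. -/
theorem exists_finrank_fixedSubspace_eq {Γ : Subgroup (Matrix.orthogonalGroup (Fin n) ℝ)}
    (hirr : (naturalRep Γ).IsIrreducible) {g : Matrix.orthogonalGroup (Fin n) ℝ} (hgΓ : g ∈ Γ)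
    (hg : finrank ℝ (fixedSubspace (Subgroup.zpowers g)) + 1 = n) {k : ℕ} (hk : k ≤ n) :
    ∃ S ≤ Γ, finrank ℝ (fixedSubspace S) = k := by
  induction hk using Nat.decreasingInduction with
  | self =>
    refine ⟨⊥, bot_le, ?_⟩
    have : fixedSubspace (⊥ : Subgroup (Matrix.orthogonalGroup (Fin n) ℝ)) = ⊤ :=
      eq_top_iff.mpr fun x _ => by simp [mem_fixedSubspace]
    rw [this, finrank_top, finrank_fin_fun]
  | of_succ k _ ih =>
    obtain ⟨S, hS, hSk⟩ := ih
    have hne : fixedSubspace S ≠ ⊥ := fun h => by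
      rw [h, finrank_bot] at hSk
      omega
    obtain ⟨x, hxS, hx0⟩ := Submodule.exists_mem_ne_zero_of_ne_bot hne
    have hgtop : fixedSubspace (Subgroup.zpowers g) ≠ ⊤ := fun h => by
      rw [h, finrank_top, finrank_fin_fun] at hg
      omega
    obtain ⟨γ, hγ, hx⟩ := exists_conj_not_fixed hirr hgtop hx0
    refine ⟨S ⊔ Subgroup.zpowers (γ * g * γ⁻¹), sup_le hS ?_, ?_⟩
    · rw [Subgroup.zpowers_le]
      exact Γ.mul_mem (Γ.mul_mem hγ hgΓ) (Γ.inv_mem hγ)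
    rw [fixedSubspace_sup]
    set A := fixedSubspace S
    set B := fixedSubspace (Subgroup.zpowers (γ * g * γ⁻¹))
    have hle : finrank ℝ (fixedSubspace (Subgroup.zpowers g)) ≤ finrank ℝ B :=
      finrank_fixedSubspace_zpowers_le_conj γ g
    -- `B` has dimension at least `n - 1` and misses `x ∈ A`, so `B` is a hyperplane and `A ⊔ B` is
    -- everything; hence `A ⊓ B` has dimension `dim A - 1`.
    have hlt : finrank ℝ B < finrank ℝ (A ⊔ B : Submodule ℝ (Fin n → ℝ)) :=
      Submodule.finrank_lt_finrank_of_lt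
        (lt_of_le_of_ne le_sup_right fun h => hx (h ▸ Submodule.mem_sup_left hxS))
    have hn : finrank ℝ (A ⊔ B : Submodule ℝ (Fin n → ℝ)) ≤ n :=
      (Submodule.finrank_le _).trans (finrank_fin_fun ℝ).le
    have := Submodule.finrank_sup_add_finrank_inf_eq A B
    omega

theorem odd_finrank_fixedSubspace_zpowers (hn : Even n)
    {g : Matrix.orthogonalGroup (Fin n) ℝ} (hg : (g : Matrix (Fin n) (Fin n) ℝ).det = -1) :
    Odd (finrank ℝ (fixedSubspace (Subgroup.zpowers g))) := by
  let M : Matrix (Fin n) (Fin n) ℝ := g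
  -- `Fin n → ℝ` carries the sup norm; adjoints require the Euclidean one.
  let f := Matrix.toEuclideanLin M
  have hadj : LinearMap.adjoint f * f = 1 := by
    rw [← Matrix.toEuclideanLin_conjTranspose_eq_adjoint]
    ext1 x
    have hM : M.conjTranspose * M = 1 := Unitary.star_mul_self_of_mem g.2
    rw [Module.End.mul_apply, Matrix.toLpLin_apply, Matrix.toLpLin_apply,
      Matrix.mulVec_mulVec, hM, Matrix.one_mulVec]
    rfl
  have hdet : LinearMap.det f = -1 := by
    rw [← hg, ← LinearMap.det_toLin (EuclideanSpace.basisFun (Fin n) ℝ).toBasis,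
      ← Matrix.toEuclideanLin_eq_toLin_orthonormal]
  have hodd := LinearMap.odd_finrank_ker_sub_one (by simpa using hn) f hadj hdet
  have hmap : fixedSubspace (Subgroup.zpowers g) =
      (LinearMap.ker (f - 1)).map (WithLp.linearEquiv 2 ℝ (Fin n → ℝ)).toLinearMap := by
    ext x
    rw [mem_fixedSubspace_zpowers, Submodule.mem_map_equiv, LinearMap.mem_ker,
      LinearMap.sub_apply, sub_eq_zero, Module.End.one_apply]
    exact (WithLp.toLp_injective 2).eq_iff.symm
  rwa [hmap, LinearEquiv.finrank_map_eq]

end FiniteOrthogonal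

theorem lemmaA6 (Γ : Subgroup (Matrix.orthogonalGroup (Fin 4) ℝ)) (hfin : Finite Γ)
    (hSO : ¬ ∀ γ ∈ Γ, (γ : Matrix (Fin 4) (Fin 4) ℝ) ∈ Matrix.specialOrthogonalGroup (Fin 4) ℝ)
    (hirr : (FiniteOrthogonal.naturalRep Γ).IsIrreducible) :
    ∃ L : Submodule ℝ (Fin 4 → ℝ), FiniteOrthogonal.IsAxisOfSymmetry Γ L := by
  push Not at hSO
  obtain ⟨g, hgΓ, hg⟩ := hSO
  have hdet : (g : Matrix (Fin 4) (Fin 4) ℝ).det = -1 := by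
    have h1 : (g : Matrix (Fin 4) (Fin 4) ℝ).det ≠ 1 := fun h =>
      hg (Matrix.mem_specialOrthogonalGroup_iff.mpr ⟨g.2, h⟩)
    have h2 := congrArg Matrix.det (Unitary.star_mul_self_of_mem g.2)
    rw [Matrix.det_mul, Matrix.star_eq_conjTranspose, Matrix.det_conjTranspose, star_trivial,
      Matrix.det_one] at h2
    exact (mul_self_eq_one_iff.mp h2).resolve_left h1
  have hodd := FiniteOrthogonal.odd_finrank_fixedSubspace_zpowers (by decide) hdet
  suffices ∃ S ≤ Γ, finrank ℝ (FiniteOrthogonal.fixedSubspace S) = 1 by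
    obtain ⟨S, hS, h⟩ := this
    exact ⟨_, h, S, hS, rfl⟩
  have hle := (Submodule.finrank_le
    (FiniteOrthogonal.fixedSubspace (Subgroup.zpowers g))).trans (finrank_fin_fun ℝ).le
  obtain ⟨m, hm⟩ := hodd
  obtain h | h : m = 0 ∨ m = 1 := by omega
  · exact ⟨Subgroup.zpowers g, by rwa [Subgroup.zpowers_le], by omega⟩
  · exact FiniteOrthogonal.exists_finrank_fixedSubspace_eq hirr hgΓ (by omega) (by norm_num)
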